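/- Let $S^7=\{x\in\mathbb R^8:|x|=1\}$, with coordinates $x=(x_0,\dots,x_7)$, and let $X_1,\dots,X_7$ be the vector fields on $S^7$ given by $$\begin{aligned} X_1(x)&=(-x_1,x_0,-x_3,x_2,-x_5,x_4,-x_7,x_6),\\ X_2(x)&=(-x_2,x_3,x_0,-x_1,-x_6,x_7,x_4,-x_5),\\ X_3(x)&=(-x_3,-x_2,x_1,x_0,x_7,x_6,-x_5,-x_4),\\ X_4(x)&=(-x_4,x_5,x_6,-x_7,x_0,-x_1,-x_2,x_3),\\ X_5(x)&=(-x_5,-x_4,-x_7,-x_6,x_1,x_0,x_3,x_2),\\ X_6(x)&=(-x_6,x_7,-x_4,x_5,x_2,-x_3,x_0,-x_1),\\ X_7(x)&=(-x_7,-x_6,x_5,x_4,-x_3,-x_2,x_1,x_0). \end{aligned}$$ Let $\mathcal H=\ker\omega\subset TS^7$ be the contact distribution, where $\omega=\sum_{j=0}^{3}(x_{2j}\,dx_{2j+1}-x_{2j+1}\,dx_{2j})$, and let $\langle\cdot,\cdot\rangle_{sR}$ be the restriction to $\mathcal H$ of the Euclidean inner product of $\mathbb R^8$. For a sub-Riemannian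 manifold $(M,\mathcal H,\langle\cdot,\cdot\rangle_{sR})$ of dimension $n$ whose distribution is regular of rank $k$ and bracket generating of step two, equip $T_pM/\mathcal H_p$ with the quotient norm induced by the surjection $\mathcal H_p\otimes\mathcal H_p\to T_pM/\mathcal H_p$, $v\otimes w\mapsto[V,W](p)\bmod\mathcal H_p$ ($V,W$ smooth sections of $\mathcal H$ extending $v,w$). Popp's volume form $\mu_{sR}$ is the smooth $n$-form, determined up to orientation, with $\mu_{sR}(b_1,\dots,b_n)=\pm1$ at each $p$ whenever $b_1,\dots,b_k$ is an orthonormal basis of $\mathcal H_p$ and the classes of $b_{k+1},\dots,b_n$ form an orthonormal basis of $T_pM/\mathcal H_p$. The intrinsic sub-Laplacian of a $C^2$ function $f:M\to\mathbb R$ is $\Delta_{sR}f=\operatorname{div}_{sR}(\nabla_{sR}f)$, where $\nabla_{sR}f$ is the section of $\mathcal H$ with $\langle\nabla_{sR}f(p),v\rangle_{sR}=d_pf(v)$ for all $v\in\mathcal H_p$, and $\operatorname{div}_{sR}X$ is defined by $L_X\mu_{sR}=(\operatorname{div}_{sR}X)\,\mu_{sR}$. **Theorem.** The fields $X_1,\dots,X_7$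 form an orthonormal frame of $TS^7$, $\mathcal H=\mathrm{span}\{X_2,\dots,X_7\}$, and $(S^7,\mathcal H,\langle\cdot,\cdot\rangle_{sR})$ is a sub-Riemannian manifold with a smooth distribution of rank $6$ that is bracket generating of step two. It has a Popp volume form, and for every $f\in C^2(S^7)$ its intrinsic sub-Laplacian is $$\Delta_{sR}f=\sum_{a=2}^{7}X_a(X_af).$$ -/

import Mathlib

open scoped Manifold ContDiff

noncomputable section

namespace SubRiem

section General

variable {E : Type*} [NormedAddCommGroup E] [NormedSpace ℝ E]
  {H : Type*} [TopologicalSpace H] {I : ModelWithCorners ℝ E H}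
  {M : Type*} [TopologicalSpace M] [ChartedSpace H M] [IsManifold I ∞ M]

/-- `V` is a vector field of class `C^r` on `M`. -/
def IsVectorField (r : ℕ∞ω) (V : Π x : M, TangentSpace I x) : Prop :=
  ContMDiff I I.tangent r (fun x => (⟨x, V x⟩ : TangentBundle I M))

/-- The derivative `V f` of a function along a vector field. -/
def derivAlong (V : Π x : M, TangentSpace I x) (f : M → ℝ) : M → ℝ :=
  fun x => mvfderiv I f x (V x)

variable (I M) in
/-- A field of tangent subspaces together with a field of bilinear forms on them. The laws that
make this a sub-Riemannian structure are those of `PreStructure.IsRegularStepTwo`. -/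
structure PreStructure where
  /-- the distribution -/
  dist : Π x : M, Submodule ℝ (TangentSpace I x)
  /-- the fibre metric on the distribution -/
  metric : Π x : M, dist x →ₗ[ℝ] dist x →ₗ[ℝ] ℝ

namespace PreStructure

variable (S : PreStructure I M)

/-- A section of the distribution that is smooth as a vector field. -/
def IsSmoothHorizontal (V : Π x : M, S.dist x) : Prop :=
  IsVectorField (I := I) ∞ (fun x => (V x : TangentSpace I x))

/-- The Lie bracket `[V, W]` at `p` of two sections of the distribution. -/
def bracket (V W : Π x : M, S.dist x) (p : M) : TangentSpace I p :=
  VectorField.mlieBracket I (fun x => (V x : TangentSpace I x))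
    (fun x => (W x : TangentSpace I x)) p

/-- `S` is a sub-Riemannian structure whose distribution is smooth of constant rank `k`, has
corank `m`, and is bracket generating of step (at most) two. -/
structure IsRegularStepTwo (k m : ℕ) : Prop where
  finrank_tangent : Module.finrank ℝ E = k + m
  finrank_dist : ∀ p, Module.finrank ℝ (S.dist p) = k
  exists_frame : ∀ p, ∃ F : Fin k → Π x : M, S.dist x, (∀ i, S.IsSmoothHorizontal (F i)) ∧
    ∀ᶠ x in nhds p, LinearIndependent ℝ (fun i => F i x)
  symm : ∀ p (v w : S.dist p), S.metric p v w = S.metric p w v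
  pos : ∀ p (v : S.dist p), v ≠ 0 → 0 < S.metric p v v
  smooth_metric : ∀ V W : Π x : M, S.dist x, S.IsSmoothHorizontal V → S.IsSmoothHorizontal W →
    ContMDiff I 𝓘(ℝ, ℝ) ∞ (fun x => S.metric x (V x) (W x))
  bracket_generating : ∀ p, S.dist p ⊔ Submodule.span ℝ {u | ∃ V W : Π x : M, S.dist x,
    S.IsSmoothHorizontal V ∧ S.IsSmoothHorizontal W ∧ u = S.bracket V W p} = ⊤

/-- `e` is an orthonormal basis of the fibre of the distribution at `p`. -/
def IsOrthonormalBasisAt {k : ℕ} (p : M) (e : Fin k → S.dist p) : Prop :=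
  (∀ i j, S.metric p (e i) (e j) = if i = j then 1 else 0) ∧
    Submodule.span ℝ (Set.range e) = ⊤

/-- The square of Popp's norm of the class of `u` in `T_pM / H_p`, where `H` is the distribution,
of rank `k`. It is the quotient norm for the surjection `H_p ⊗ H_p → T_pM / H_p` which sends
`v ⊗ w` to the class of `[V, W](p)`, for any smooth sections `V`, `W` of `H` with `V p = v`,
`W p = w`; that is, the infimum of `‖ξ‖² = ∑ᵢⱼ aᵢⱼ²` over the tensors `ξ = ∑ᵢⱼ aᵢⱼ eᵢ ⊗ eⱼ` that
are sent to the class of `u`, where `e` is an orthonormal basis of `H_p`. -/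
def poppNormSq (k : ℕ) (p : M) (u : TangentSpace I p) : ℝ :=
  sInf {s : ℝ | ∃ (F : Fin k → Π x : M, S.dist x) (a : Fin k → Fin k → ℝ),
    (∀ i, S.IsSmoothHorizontal (F i)) ∧
    S.IsOrthonormalBasisAt p (fun i => F i p) ∧
    u - ∑ i, ∑ j, a i j • S.bracket (F i) (F j) p ∈ S.dist p ∧
    s = ∑ i, ∑ j, a i j ^ 2}

/-- `(e, z)` is a basis of `T_pM` for which `e` is an orthonormal basis of `H_p` and the classes
of `z` are an orthonormal basis of `T_pM / H_p` for Popp's norm (orthonormality being expressed by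
`‖∑ cᵢ zᵢ‖² = ∑ cᵢ²`). -/
def IsPoppFrameAt {k m : ℕ} (p : M) (e : Fin k → S.dist p) (z : Fin m → TangentSpace I p) :
    Prop :=
  S.IsOrthonormalBasisAt p e ∧
    (∀ c : Fin m → ℝ, S.poppNormSq k p (∑ i, c i • z i) = ∑ i, c i ^ 2) ∧
    S.dist p ⊔ Submodule.span ℝ (Set.range z) = ⊤

end PreStructure

/-- `μ` is a smooth differential form of degree `n`. -/
def IsSmoothForm {n : ℕ} (μ : Π x : M, TangentSpace I x [⋀^Fin n]→ₗ[ℝ] ℝ) : Prop :=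
  ∀ Y : Fin n → Π x : M, TangentSpace I x, (∀ i, IsVectorField ∞ (Y i)) →
    ContMDiff I 𝓘(ℝ, ℝ) ∞ (fun x => μ x (fun i => Y i x))

/-- The Lie derivative of an `n`-form, evaluated on vector fields:
`(L_X μ)(Y₁, …, Yₙ) = X (μ(Y₁, …, Yₙ)) - ∑ᵢ μ(Y₁, …, [X, Yᵢ], …, Yₙ)`. -/
def lieDerivForm {n : ℕ} (μ : Π x : M, TangentSpace I x [⋀^Fin n]→ₗ[ℝ] ℝ)
    (X : Π x : M, TangentSpace I x) (Y : Fin n → Π x : M, TangentSpace I x) (p : M) : ℝ :=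
  derivAlong X (fun x => μ x (fun i => Y i x)) p -
    ∑ i, μ p (Function.update (fun j => Y j p) i (VectorField.mlieBracket I X (Y i) p))

/-- The `C¹` vector field `X` has divergence `d` with respect to `μ`: `L_X μ = d μ`. -/
def IsDivergence {n : ℕ} (μ : Π x : M, TangentSpace I x [⋀^Fin n]→ₗ[ℝ] ℝ)
    (X : Π x : M, TangentSpace I x) (d : M → ℝ) : Prop :=
  IsVectorField 1 X ∧
    ∀ Y : Fin n → Π x : M, TangentSpace I x, (∀ i, IsVectorField ∞ (Y i)) →
      ∀ p, lieDerivForm μ X Y p = d p * μ p (fun i => Y i p)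

namespace PreStructure

variable (S : PreStructure I M)

/-- `μ` is a Popp volume form of a regular step-two structure of rank `k` and corank `m`: a smooth
form of top degree which is `±1` on every Popp frame. (On a connected orientable manifold this
determines `μ` up to the sign, that is, up to the choice of an orientation.) -/
def IsPoppVolume (k m : ℕ) (μ : Π x : M, TangentSpace I x [⋀^Fin (k + m)]→ₗ[ℝ] ℝ) : Prop :=
  IsSmoothForm μ ∧
    ∀ p (e : Fin k → S.dist p) (z : Fin m → TangentSpace I p), S.IsPoppFrameAt p e z →
      |μ p (Fin.append (fun i => (e i : TangentSpace I p)) z)| = 1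

/-- `G` is the horizontal gradient of `f`: the section of the distribution with
`⟨G(p), v⟩ = d_p f(v)` for all horizontal `v`. -/
def IsHorizontalGradient (f : M → ℝ) (G : Π x : M, S.dist x) : Prop :=
  ∀ p (v : S.dist p), S.metric p (G p) v = mvfderiv I f p (v : TangentSpace I p)

/-- `h` is the intrinsic sub-Laplacian of `f`: the divergence, with respect to Popp's volume form,
of the horizontal gradient of `f`. -/
def IsIntrinsicSubLaplacian (k m : ℕ) (f h : M → ℝ) : Prop :=
  ∃ μ : Π x : M, TangentSpace I x [⋀^Fin (k + m)]→ₗ[ℝ] ℝ, S.IsPoppVolume k m μ ∧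
    ∃ G : Π x : M, S.dist x, S.IsHorizontalGradient f G ∧
      IsDivergence μ (fun x => (G x : TangentSpace I x)) h

end PreStructure

end General

/-- `ℝ⁸` with its Euclidean inner product; the coordinates are `x₀, …, x₇`. -/
abbrev R8 : Type := EuclideanSpace ℝ (Fin 8)

instance finrank_R8 : Fact (Module.finrank ℝ R8 = 7 + 1) := ⟨by simp⟩

/-- The unit sphere `S⁷` of `ℝ⁸`. -/
abbrev S7 : Type := Metric.sphere (0 : R8) 1

/-- The differential at `p` of the inclusion `S⁷ → ℝ⁸`. -/
def dincl (p : S7) : TangentSpace (𝓡 7) p →L[ℝ] R8 :=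
  mvfderiv (𝓡 7) (fun x : S7 => (x : R8)) p

/-- The seven linear vector fields on `ℝ⁸` given by octonion multiplication; the entry with
index `a` is the field usually numbered `a + 1`. -/
def octonionField (a : Fin 7) (x : R8) : R8 :=
  ![!₂[-x 1, x 0, -x 3, x 2, -x 5, x 4, -x 7, x 6],
    !₂[-x 2, x 3, x 0, -x 1, -x 6, x 7, x 4, -x 5],
    !₂[-x 3, -x 2, x 1, x 0, x 7, x 6, -x 5, -x 4],
    !₂[-x 4, x 5, x 6, -x 7, x 0, -x 1, -x 2, x 3],
    !₂[-x 5, -x 4, -x 7, -x 6, x 1, x 0, x 3, x 2],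
    !₂[-x 6, x 7, -x 4, x 5, x 2, -x 3, x 0, -x 1],
    !₂[-x 7, -x 6, x 5, x 4, -x 3, -x 2, x 1, x 0]] a

theorem inner_octonionField (a : Fin 7) (x : R8) : inner ℝ x (octonionField a x) = 0 := by
  fin_cases a <;> simp [octonionField, PiLp.inner_apply, Fin.sum_univ_eight] <;> ring

theorem exists_dincl_eq (a : Fin 7) (p : S7) : ∃ v, dincl p v = octonionField a p := by
  have h := range_mvfderiv_subtypeVal (n := 7) p
  have h2 : octonionField a (p : R8) ∈ (ℝ ∙ (p : R8))ᗮ :=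
    Submodule.mem_orthogonal_singleton_iff_inner_right.2 (inner_octonionField a p)
  rw [← h] at h2
  exact h2

/-- The frame `X₁, …, X₇` of `TS⁷` (with indices shifted by one: `X a` is `X_{a+1}`): the
restrictions to `S⁷` of the octonionic fields of `ℝ⁸`, which are tangent to `S⁷`. -/
def X (a : Fin 7) (p : S7) : TangentSpace (𝓡 7) p := (exists_dincl_eq a p).choose

theorem dincl_X (a : Fin 7) (p : S7) : dincl p (X a p) = octonionField a p :=
  (exists_dincl_eq a p).choose_spec

/-- The contact form
`ω = x₀ dx₁ - x₁ dx₀ + x₂ dx₃ - x₃ dx₂ + x₄ dx₅ - x₅ dx₄ + x₆ dx₇ - x₇ dx₆` on `S⁷`. -/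
def contactForm (p : S7) : TangentSpace (𝓡 7) p →ₗ[ℝ] ℝ :=
  (innerₗ R8 !₂[-p.1 1, p.1 0, -p.1 3, p.1 2, -p.1 5, p.1 4, -p.1 7, p.1 6]) ∘ₗ
    (dincl p : TangentSpace (𝓡 7) p →ₗ[ℝ] R8)

/-- The metric of `S⁷` induced by the Euclidean inner product of `ℝ⁸`. -/
def roundMetric (p : S7) : TangentSpace (𝓡 7) p →ₗ[ℝ] TangentSpace (𝓡 7) p →ₗ[ℝ] ℝ :=
  (innerₗ R8).compl₁₂ (dincl p : TangentSpace (𝓡 7) p →ₗ[ℝ] R8)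
    (dincl p : TangentSpace (𝓡 7) p →ₗ[ℝ] R8)

/-- `S⁷` with its contact distribution `ker ω` and the restriction of the round metric to it. -/
def contactS7 : PreStructure (𝓡 7) S7 where
  dist p := LinearMap.ker (contactForm p)
  metric p := (roundMetric p).compl₁₂ (LinearMap.ker (contactForm p)).subtype
    (LinearMap.ker (contactForm p)).subtype

end SubRiem

end

/-! Write J_a for the linear map `octonionField a`, a = 0, …, 6, and X_a for its restriction to the
sphere. Each J_a is skew with J_a² = -1, and the vectors J_a x are mutually orthogonal of length
|x|. Brackets are computed in ℝ⁸, where [V, W] becomes D_V W - D_W V; by skewness ⟨[V, W], X_k⟩ =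
V⟨W, X_k⟩ - W⟨V, X_k⟩ - 2⟨W, J_k V⟩ (`roundMetric_mlieBracket_X`).

For horizontal V, W and k = 0 only the last term survives. As J_0 acts isometrically on H_p, the
bracket map H_p ⊗ H_p → T_p/H_p ≅ ℝ has squared Hilbert-Schmidt norm 6 · 4 = 24 at every point.
Hence Popp's norm is |ω|/√24 (`poppNormSq_eq`), and the Popp volumes are the smooth top forms with
|μ(X_0, …, X_6)| = 1/√24 (`isPoppVolume_iff`).

For a form μ with μ(X_0, …, X_6) locally constant, div G = ∑ X_a⟨G, X_a⟩ (`lieDerivForm_eq`),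
because the zeroth-order terms 2⟨X_a, J_a G⟩ = 2⟨p, G⟩ vanish. The horizontal gradient has
coefficients 0 for a = 0 and X_a f for a ≥ 1, which leaves a sum of squares without first-order
term. -/

namespace SubRiem

/-! ### The Lie bracket as a commutator of derivations. -/

section General

variable {E : Type*} [NormedAddCommGroup E] [NormedSpace ℝ E]
  {H : Type*} [TopologicalSpace H] {I : ModelWithCorners ℝ E H}
  {M : Type*} [TopologicalSpace M] [ChartedSpace H M] [IsManifold I ∞ M]
  {F : Type*} [NormedAddCommGroup F] [NormedSpace ℝ F]

/-- The derivative of a `C^n` function along a `C^m` vector field, `m + 1 ≤ n`, is `C^m`. -/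
theorem IsVectorField.contMDiff_mvfderiv {m n : ℕ∞ω} {V : Π x : M, TangentSpace I x}
    (hV : IsVectorField m V) {f : M → F} (hf : ContMDiff I 𝓘(ℝ, F) n f) (hmn : m + 1 ≤ n) :
    ContMDiff I 𝓘(ℝ, F) m (fun x => mvfderiv I f x (V x)) :=
  (contMDiff_snd_tangentBundle_modelSpace F 𝓘(ℝ, F)).comp
    ((hf.contMDiff_tangentMap hmn).comp hV)

theorem fderivWithin_comp_extChartAt_symm {f : M → F} {x : M} {z : E}
    (hz : z ∈ (extChartAt I x).target)
    (hf : MDifferentiableAt I 𝓘(ℝ, F) f ((extChartAt I x).symm z)) (u : E) :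
    fderivWithin ℝ (f ∘ (extChartAt I x).symm) (Set.range I) z u =
      mvfderiv I f ((extChartAt I x).symm z)
        (mfderivWithin 𝓘(ℝ, E) I (extChartAt I x).symm (Set.range I) z u) := by
  have h2 := mfderiv_comp_mfderivWithin (I := 𝓘(ℝ, E)) (I' := I) (I'' := 𝓘(ℝ, F)) z hf
    (mdifferentiableWithinAt_extChartAt_symm hz)
    (I.uniqueMDiffOn z (extChartAt_target_subset_range x hz))
  rw [mfderivWithin_eq_fderivWithin] at h2
  rw [h2]
  rfl

variable (I) in
/-- The expression of the vector field `V` in the chart at `x`. -/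
noncomputable def fieldInChart (V : Π x : M, TangentSpace I x) (x : M) : E → E :=
  VectorField.mpullbackWithin 𝓘(ℝ, E) I (extChartAt I x).symm V (Set.range I)

theorem fderivWithin_fieldInChart {f : M → F} {x : M} {z : E}
    (hz : z ∈ (extChartAt I x).target)
    (hf : MDifferentiableAt I 𝓘(ℝ, F) f ((extChartAt I x).symm z))
    (V : Π x : M, TangentSpace I x) :
    fderivWithin ℝ (f ∘ (extChartAt I x).symm) (Set.range I) z (fieldInChart I V x z) =
    mvfderiv I f ((extChartAt I x).symm z) (V ((extChartAt I x).symm z)) :=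
  (fderivWithin_comp_extChartAt_symm hz hf _).trans <|
    congrArg _ ((isInvertible_mfderivWithin_extChartAt_symm (I := I) hz).self_apply_inverse _)

variable [CompleteSpace E]

/-- The derivation along `[V, W]` is the commutator of the derivations along `V` and `W`. -/
theorem mvfderiv_mlieBracket {f : M → F} (hf : ContMDiff I 𝓘(ℝ, F) 2 f)
    {V W : Π x : M, TangentSpace I x} (hV : IsVectorField 1 V) (hW : IsVectorField 1 W) (x : M) :
    mvfderiv I f x (VectorField.mlieBracket I V W x) =
      mvfderiv I (fun y => mvfderiv I f y (W y)) x (V x) -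
        mvfderiv I (fun y => mvfderiv I f y (V y)) x (W x) := by
  have hfd : MDifferentiable I 𝓘(ℝ, F) f := hf.mdifferentiable two_ne_zero
  have key : ∀ {g : M → F} (_ : MDifferentiable I 𝓘(ℝ, F) g) (U : Π x : M, TangentSpace I x),
      fderivWithin ℝ (g ∘ (extChartAt I x).symm) (Set.range I) (extChartAt I x x)
      (fieldInChart I U x (extChartAt I x x)) = mvfderiv I g x (U x) := fun hg U => by
    rw [fderivWithin_fieldInChart (mem_extChartAt_target x) (hg _) U, extChartAt_to_inv]
  have hdiff : ∀ {U : Π x : M, TangentSpace I x}, IsVectorField 1 U → DifferentiableWithinAt ℝ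
      (fieldInChart I U x) (Set.range I) (extChartAt I x x) := fun {U} hU => by
    have h := (hU.mdifferentiable one_ne_zero x).mdifferentiableWithinAt (s := Set.univ)
      |>.differentiableWithinAt_mpullbackWithin_vectorField
    rwa [Set.preimage_univ, Set.univ_inter] at h
  have hcongr : ∀ {U : Π x : M, TangentSpace I x}, IsVectorField 1 U →
      fderivWithin ℝ (fun z => fderivWithin ℝ (f ∘ (extChartAt I x).symm) (Set.range I) z
        (fieldInChart I U x z)) (Set.range I) (extChartAt I x x) =
      fderivWithin ℝ ((fun y => mvfderiv I f y (U y)) ∘ (extChartAt I x).symm) (Set.range I)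
        (extChartAt I x x) := fun {U} hU => by
    refine Filter.EventuallyEq.fderivWithin_eq_of_mem ?_ (Set.mem_range_self _)
    filter_upwards [extChartAt_target_mem_nhdsWithin (I := I) x] with z hz
    exact fderivWithin_fieldInChart hz (hfd _) U
  have hf' : ContDiffWithinAt ℝ 2 (f ∘ (extChartAt I x).symm) (Set.range I)
      (extChartAt I x x) := (contMDiffAt_iff.1 (hf x)).2
  -- The commutator identity in the model space `E`. Symmetry of the second derivative of `f` enters
  -- here, hence the assumption C².
  have hL := VectorField.fderivWithin_apply_lieBracket hf' (by simp) I.uniqueDiffOn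
    (I.range_subset_closure_interior (Set.mem_range_self _)) (Set.mem_range_self _)
    (hdiff hW) (hdiff hV)
  rw [hcongr hW, hcongr hV,
    key ((hW.contMDiff_mvfderiv hf (by norm_num)).mdifferentiable one_ne_zero) V,
    key ((hV.contMDiff_mvfderiv hf (by norm_num)).mdifferentiable one_ne_zero) W] at hL
  have h3 := isInvertible_mfderiv_extChartAt (I := I) (mem_extChartAt_source (I := I) x)
  have h4 := fun u => DFunLike.congr_fun (mfderivWithin_extChartAt_symm_comp_mfderiv_extChartAt'
    (I := I) (mem_extChartAt_source (I := I) x)) u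
  -- The bracket on `M` is the pullback of the bracket in the chart; pushing it forward again
  -- cancels the differential of the chart.
  have h5 : mfderivWithin 𝓘(ℝ, E) I (extChartAt I x).symm (Set.range I) (extChartAt I x x)
      (VectorField.lieBracketWithin (E := E) ℝ (fieldInChart I V x) (fieldInChart I W x) (Set.range I)
        (extChartAt I x x)) = VectorField.mlieBracket I V W x := by
    rw [← VectorField.mlieBracketWithin_univ, VectorField.mlieBracketWithin_apply,
      Set.preimage_univ, Set.univ_inter]
    refine Eq.trans ?_ (h4 _)
    exact congrArg _ (h3.self_apply_inverse _).symm
  rw [← hL, fderivWithin_comp_extChartAt_symm (mem_extChartAt_target x) (hfd _), h5,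
    extChartAt_to_inv]

end General
-- Octonionic linear algebra and a determinant identity.
section Algebra

theorem inner_octonionField_octonionField (a b : Fin 7) (x : R8) :
    inner ℝ (octonionField a x) (octonionField b x) = if a = b then inner ℝ x x else 0 := by
  fin_cases a <;> fin_cases b <;>
    simp [octonionField, PiLp.inner_apply, Fin.sum_univ_eight,
      -inner_self_eq_norm_sq_to_K] <;> ring

theorem inner_octonionField_left (a : Fin 7) (x y : R8) :
    inner ℝ (octonionField a x) y = -inner ℝ x (octonionField a y) := by
  fin_cases a <;> simp [octonionField, PiLp.inner_apply, Fin.sum_univ_eight] <;> ring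

theorem octonionField_octonionField (a : Fin 7) (x : R8) :
    octonionField a (octonionField a x) = -x := by
  ext i
  fin_cases a <;> fin_cases i <;> simp [octonionField]

/-- The octonionic fields as linear maps. -/
noncomputable def octonionMap (a : Fin 7) : R8 →L[ℝ] R8 :=
  LinearMap.toContinuousLinearMap
    { toFun := octonionField a
      map_add' := fun x y => by
        ext i
        fin_cases a <;> fin_cases i <;> simp [octonionField] <;> ring
      map_smul' := fun c x => by
        ext i
        fin_cases a <;> fin_cases i <;> simp [octonionField] }

theorem octonionMap_apply (a : Fin 7) (x : R8) : octonionMap a x = octonionField a x := rfl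

/-- Expanding along the replaced rows gives tr(A B adj A) = tr(B adj A · A). Since A need not be
invertible, the divergence can later be tested on arbitrary fields, not only on frames. -/
theorem sum_det_updateRow_mul {n R : Type*} [Fintype n] [DecidableEq n] [CommRing R]
    (A B : Matrix n n R) :
    ∑ i, (A.updateRow i ((A * B) i)).det = B.trace * A.det := by
  have h : ∀ i (r : n → R), (A.updateRow i r).det = ∑ k, r k * A.adjugate k i := fun i r => by
    rw [Matrix.det_eq_sum_mul_adjugate_row _ i]
    simp [Matrix.adjugate_apply]
  simp only [h]
  change (A * B * A.adjugate).trace = _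
  rw [Matrix.mul_assoc, Matrix.trace_mul_comm, Matrix.mul_assoc, Matrix.adjugate_mul]
  simp [mul_comm]

end Algebra

/-! ### Derivatives of inner products and determinants. -/

section Calculus

variable {E : Type*} [NormedAddCommGroup E] [NormedSpace ℝ E]
  {H : Type*} [TopologicalSpace H] {I : ModelWithCorners ℝ E H}
  {M : Type*} [TopologicalSpace M] [ChartedSpace H M]
  {F : Type*} [NormedAddCommGroup F] [NormedSpace ℝ F]
  {F' : Type*} [NormedAddCommGroup F'] [NormedSpace ℝ F']

theorem mvfderiv_comp_of_hasFDerivAt {φ : F → F'} {φ' : F →L[ℝ] F'} {g : M → F} {x : M}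
    (hφ : HasFDerivAt φ φ' (g x)) (hg : MDifferentiableAt I 𝓘(ℝ, F) g x) (v : TangentSpace I x) :
    mvfderiv I (fun y => φ (g y)) x v = φ' (mvfderiv I g x v) := by
  have h := mfderiv_comp_apply (I' := 𝓘(ℝ, F)) (I'' := 𝓘(ℝ, F')) x
    hφ.differentiableAt.mdifferentiableAt hg v
  rw [mfderiv_eq_fderiv, hφ.fderiv] at h
  exact h

theorem mvfderiv_clm_apply (L : F →L[ℝ] F') {g : M → F} {x : M}
    (hg : MDifferentiableAt I 𝓘(ℝ, F) g x) (v : TangentSpace I x) :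
    mvfderiv I (fun y => L (g y)) x v = L (mvfderiv I g x v) :=
  mvfderiv_comp_of_hasFDerivAt L.hasFDerivAt hg v

theorem mvfderiv_inner {N : Type*} [NormedAddCommGroup N] [InnerProductSpace ℝ N] {g h : M → N}
    {x : M} (hg : MDifferentiableAt I 𝓘(ℝ, N) g x) (hh : MDifferentiableAt I 𝓘(ℝ, N) h x)
    (v : TangentSpace I x) :
    mvfderiv I (fun y => (inner ℝ (g y) (h y) : ℝ)) x v =
      inner ℝ (g x) (mvfderiv I h x v) + inner ℝ (mvfderiv I g x v) (h x) := by
  have hp := hg.prodMk_space hh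
  have hd := mvfderiv_comp_of_hasFDerivAt (g := fun y => (g y, h y))
    ((isBoundedBilinearMap_inner (𝕜 := ℝ) (E := N)).hasFDerivAt (g x, h x)) hp v
  dsimp only at hd
  rw [hd]
  have h1 := mvfderiv_clm_apply (ContinuousLinearMap.fst ℝ N N) hp v
  have h2 := mvfderiv_clm_apply (ContinuousLinearMap.snd ℝ N N) hp v
  simp only [ContinuousLinearMap.coe_fst', ContinuousLinearMap.coe_snd'] at h1 h2
  rw [h1, h2]
  rfl

/-- The determinant as a continuous multilinear function of the rows. -/
def detContinuousMultilinear (n : Type*) [Fintype n] [DecidableEq n] :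
    ContinuousMultilinearMap ℝ (fun _ : n => n → ℝ) ℝ :=
  { Matrix.detRowAlternating.toMultilinearMap with
    cont := Continuous.matrix_det continuous_id }

theorem contMDiff_det {n : Type*} [Fintype n] [DecidableEq n] {r : ℕ∞ω} {y : n → n → M → ℝ}
    (hy : ∀ i j, ContMDiff I 𝓘(ℝ, ℝ) r (y i j)) :
    ContMDiff I 𝓘(ℝ, ℝ) r (fun q => (Matrix.of fun i j => y i j q).det) := by
  have hg : ContMDiff I 𝓘(ℝ, n → n → ℝ) r (fun q i j => y i j q) :=
    contMDiff_pi_space.2 fun i => contMDiff_pi_space.2 fun j => hy i j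
  exact (detContinuousMultilinear n).contDiff.contMDiff.comp hg

theorem mvfderiv_det {n : Type*} [Fintype n] [DecidableEq n] {y : n → n → M → ℝ}
    (hy : ∀ i j, ContMDiff I 𝓘(ℝ, ℝ) 1 (y i j)) (x : M) (v : TangentSpace I x) :
    mvfderiv I (fun q => (Matrix.of fun i j => y i j q).det) x v =
      ∑ i, ((Matrix.of fun i j => y i j x).updateRow i fun j => mvfderiv I (y i j) x v).det := by
  have hg : ContMDiff I 𝓘(ℝ, n → n → ℝ) 1 (fun q i j => y i j q) :=
    contMDiff_pi_space.2 fun i => contMDiff_pi_space.2 fun j => hy i j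
  refine (mvfderiv_comp_of_hasFDerivAt ((detContinuousMultilinear n).hasFDerivAt _)
    (hg.mdifferentiable one_ne_zero x) v).trans ?_
  rw [ContinuousMultilinearMap.linearDeriv_apply]
  refine Finset.sum_congr rfl fun i _ => ?_
  have h : (mvfderiv I (fun q i j => y i j q) x v : n → n → ℝ) i =
      fun j => mvfderiv I (y i j) x v := funext fun j =>
    (mvfderiv_clm_apply ((ContinuousLinearMap.proj j : (n → ℝ) →L[ℝ] ℝ).comp
      (ContinuousLinearMap.proj (φ := fun _ : n => n → ℝ) i)) (hg.mdifferentiable one_ne_zero x) v).symm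
  rw [h]
  rfl

end Calculus

/-! ### The orthonormal frame and the contact distribution. -/

theorem inner_self_S7 (p : S7) : inner ℝ (p : R8) (p : R8) = 1 := by
  have := p.2
  simp only [Metric.mem_sphere, dist_zero_right] at this
  rw [real_inner_self_eq_norm_sq, this, one_pow]

theorem dincl_injective (p : S7) : Function.Injective (dincl p) :=
  injective_mvfderiv_subtypeVal_sphere (n := 7) p

theorem range_dincl (p : S7) : (dincl p).range = (ℝ ∙ (p : R8))ᗮ :=
  range_mvfderiv_subtypeVal (n := 7) p

theorem inner_dincl (p : S7) (v : TangentSpace (𝓡 7) p) : inner ℝ (p : R8) (dincl p v) = 0 := by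
  have h : dincl p v ∈ (dincl p).range := ⟨v, rfl⟩
  rw [range_dincl] at h
  exact Submodule.mem_orthogonal_singleton_iff_inner_right.1 h

theorem exists_dincl_eq_of_inner_eq_zero {p : S7} {w : R8} (h : inner ℝ (p : R8) w = 0) :
    ∃ v, dincl p v = w := by
  have h2 := Submodule.mem_orthogonal_singleton_iff_inner_right.2 h
  rw [← range_dincl] at h2
  exact h2

theorem roundMetric_apply (p : S7) (v w : TangentSpace (𝓡 7) p) :
    roundMetric p v w = inner ℝ (dincl p v) (dincl p w) := rfl

theorem roundMetric_X (p : S7) (a b : Fin 7) :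
    roundMetric p (X a p) (X b p) = if a = b then 1 else 0 := by
  rw [roundMetric_apply, dincl_X, dincl_X, inner_octonionField_octonionField, inner_self_S7]

theorem roundMetric_comm (p : S7) (v w : TangentSpace (𝓡 7) p) :
    roundMetric p v w = roundMetric p w v :=
  real_inner_comm (dincl p w) (dincl p v)

theorem roundMetric_self_pos {p : S7} {v : TangentSpace (𝓡 7) p} (hv : v ≠ 0) :
    0 < roundMetric p v v :=
  real_inner_self_pos.2 fun h => hv (dincl_injective p (h.trans (map_zero _).symm))

theorem linearIndependent_X (p : S7) : LinearIndependent ℝ (fun a => X a p) := by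
  rw [Fintype.linearIndependent_iff]
  intro c hc a
  have h := congrArg (fun v => roundMetric p v (X a p)) hc
  simpa [roundMetric_X] using h

/-- The frame `X` at `p` as a basis. -/
noncomputable def frame (p : S7) : Module.Basis (Fin 7) ℝ (TangentSpace (𝓡 7) p) :=
  basisOfLinearIndependentOfCardEqFinrank (linearIndependent_X p)
    (finrank_euclideanSpace_fin (𝕜 := ℝ) (n := 7)).symm

theorem frame_apply (p : S7) (a : Fin 7) : frame p a = X a p := by
  exact congrFun (coe_basisOfLinearIndependentOfCardEqFinrank _ _) a

theorem sum_roundMetric_smul_X (p : S7) (v : TangentSpace (𝓡 7) p) :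
    ∑ a, roundMetric p v (X a p) • X a p = v := by
  have h := (frame p).sum_repr v
  conv_rhs => rw [← h]
  refine Finset.sum_congr rfl fun a _ => ?_
  rw [frame_apply]
  congr 1
  conv_lhs => rw [← h]
  simp [frame_apply, roundMetric_X]

theorem frame_repr (p : S7) (v : TangentSpace (𝓡 7) p) (a : Fin 7) :
    (frame p).repr v a = roundMetric p v (X a p) := by
  conv_rhs => rw [← (frame p).sum_repr v]
  simp [frame_apply, roundMetric_X]

theorem roundMetric_eq_sum (p : S7) (v w : TangentSpace (𝓡 7) p) :
    roundMetric p v w = ∑ a, roundMetric p v (X a p) * roundMetric p w (X a p) := by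
  conv_lhs => rw [← sum_roundMetric_smul_X p v]
  simp [roundMetric_comm p w]

/-- The coefficient vector of ω at `p` is `octonionField 0 p`, so ω is the inner product with the
first frame field and ker ω is its orthogonal complement. -/
theorem contactForm_apply (p : S7) (v : TangentSpace (𝓡 7) p) :
    contactForm p v = roundMetric p v (X 0 p) := by
  rw [roundMetric_comm, roundMetric_apply, dincl_X]
  rfl

theorem mem_dist_iff {p : S7} {v : TangentSpace (𝓡 7) p} :
    v ∈ contactS7.dist p ↔ roundMetric p v (X 0 p) = 0 := by
  rw [← contactForm_apply]
  rfl

theorem X_succ_mem_dist (p : S7) (a : Fin 6) : X a.succ p ∈ contactS7.dist p := by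
  rw [mem_dist_iff, roundMetric_X, if_neg (Fin.succ_ne_zero a)]

theorem dist_eq_span (p : S7) :
    contactS7.dist p = Submodule.span ℝ (Set.range fun a : Fin 6 => X a.succ p) := by
  apply le_antisymm
  · intro v hv
    rw [← sum_roundMetric_smul_X p v, Fin.sum_univ_succ, mem_dist_iff.1 hv, zero_smul, zero_add]
    exact Submodule.sum_mem _ fun a _ => Submodule.smul_mem _ _ (Submodule.subset_span ⟨a, rfl⟩)
  · rw [Submodule.span_le]
    rintro _ ⟨a, rfl⟩
    exact X_succ_mem_dist p a

/-! ### Smoothness of the frame. -/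

/-- The unit-speed great circle through `p` with velocity `X a p`, as a function of time and `p`. -/
noncomputable def greatCircle (a : Fin 7) (q : ℝ × S7) : S7 :=
  ⟨Real.cos q.1 • (q.2 : R8) + Real.sin q.1 • octonionMap a q.2, by
    have h : inner ℝ (octonionField a (q.2 : R8)) (q.2 : R8) = 0 := by
      rw [real_inner_comm, inner_octonionField]
    rw [mem_sphere_zero_iff_norm, ← sq_eq_sq₀ (norm_nonneg _) zero_le_one,
      ← real_inner_self_eq_norm_sq]
    simp only [octonionMap_apply, inner_add_left, inner_add_right, real_inner_smul_left,
      real_inner_smul_right, inner_octonionField_octonionField, inner_self_S7, h,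
      inner_octonionField, if_true]
    linarith [Real.sin_sq_add_cos_sq q.1]⟩

theorem contMDiff_coe_S7 {n : ℕ∞ω} : ContMDiff (𝓡 7) 𝓘(ℝ, R8) n (fun p : S7 => (p : R8)) :=
  contMDiff_coe_sphere

theorem contMDiff_greatCircle (a : Fin 7) :
    ContMDiff (𝓘(ℝ, ℝ).prod (𝓡 7)) (𝓡 7) ∞ (greatCircle a) := by
  refine ContMDiff.codRestrict_sphere (n := 7) ?_ _
  have h1 : ContMDiff (𝓘(ℝ, ℝ).prod (𝓡 7)) 𝓘(ℝ, R8) ∞ (fun q : ℝ × S7 => (q.2 : R8)) :=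
    contMDiff_coe_S7.comp contMDiff_snd
  exact ((Real.contDiff_cos.contMDiff.comp contMDiff_fst).smul h1).add
    ((Real.contDiff_sin.contMDiff.comp contMDiff_fst).smul
      ((octonionMap a).contDiff.contMDiff.comp h1))

theorem greatCircle_zero (a : Fin 7) (p : S7) : greatCircle a (0, p) = p := by
  ext1
  simp [greatCircle]

theorem eq_X_of_dincl {a : Fin 7} {p : S7} {q : TangentBundle (𝓡 7) S7} (h1 : q.1 = p)
    (h2 : dincl q.1 q.2 = octonionField a p) : q = ⟨p, X a p⟩ := by
  obtain ⟨p', v⟩ := q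
  subst h1
  congr 1
  exact dincl_injective _ (h2.trans (dincl_X a _).symm)

/-- `X a` is defined by choice, so its smoothness is not visible. It is recovered as the velocity at
time 0 of the smooth map `greatCircle a`, whose tangent map is smooth. -/
theorem isVectorField_X (a : Fin 7) : IsVectorField ∞ (X a) := by
  -- The smooth map p ↦ (∂_t at 0, zero vector at p) into the tangent bundle of ℝ × S⁷.
  have h1 : ContMDiff (𝓡 7) ((𝓘(ℝ, ℝ).prod (𝓡 7)).tangent) ∞ (fun p : S7 =>
      (equivTangentBundleProd 𝓘(ℝ, ℝ) ℝ (𝓡 7) S7).symm (⟨0, (1 : ℝ)⟩, ⟨p, 0⟩)) :=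
    contMDiff_equivTangentBundleProd_symm.comp
      (contMDiff_const.prodMk (Bundle.contMDiff_zeroSection ℝ (TangentSpace (𝓡 7))))
  have h2 := ((contMDiff_greatCircle a).contMDiff_tangentMap (m := ∞) (by simp)).comp h1
  unfold IsVectorField
  convert h2 using 2 with p
  refine (eq_X_of_dincl (greatCircle_zero a p) ?_).symm
  have hγ : MDifferentiableAt (𝓘(ℝ, ℝ).prod (𝓡 7)) (𝓡 7) (greatCircle a) (0, p) :=
    (contMDiff_greatCircle a).mdifferentiable (by simp) _
  have hι : MDifferentiableAt (𝓡 7) 𝓘(ℝ, R8) (fun p : S7 => (p : R8)) (greatCircle a (0, p)) :=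
    (contMDiff_coe_S7 (n := 1)).mdifferentiable one_ne_zero _
  have hc : MDifferentiableAt 𝓘(ℝ, ℝ) (𝓘(ℝ, ℝ).prod (𝓡 7)) (fun t : ℝ => (t, p)) 0 :=
    mdifferentiableAt_id.prodMk mdifferentiableAt_const
  have h3 := mfderiv_comp_apply (I' := 𝓘(ℝ, ℝ).prod (𝓡 7)) (0 : ℝ) (hι.comp (0, p) hγ) hc (1 : ℝ)
  rw [mfderiv_comp (0, p) hι hγ, mfderiv_prod_left] at h3
  refine h3.symm.trans ?_
  rw [mfderiv_eq_fderiv]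
  have h4 : HasDerivAt (fun t : ℝ => Real.cos t • (p : R8) + Real.sin t • octonionMap a p)
      (octonionField a p) 0 := by
    have h : HasDerivAt (fun t : ℝ => Real.cos t • (p : R8) + Real.sin t • octonionMap a p)
        (-Real.sin 0 • (p : R8) + Real.cos 0 • octonionMap a p) 0 :=
      ((Real.hasDerivAt_cos 0).smul_const (p : R8)).add ((Real.hasDerivAt_sin 0).smul_const (octonionMap a p))
    simpa [octonionMap_apply] using h
  exact (congrArg (fun L : ℝ →L[ℝ] R8 => L 1) h4.hasFDerivAt.fderiv).trans (by simp)

theorem IsVectorField.contMDiff_dincl {n : ℕ∞ω} {V : Π p : S7, TangentSpace (𝓡 7) p}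
    (hV : IsVectorField n V) : ContMDiff (𝓡 7) 𝓘(ℝ, R8) n (fun p => dincl p (V p)) :=
  hV.contMDiff_mvfderiv (contMDiff_coe_S7 (n := n + 1)) le_rfl

theorem contMDiff_roundMetric {n : ℕ∞ω} {V W : Π p : S7, TangentSpace (𝓡 7) p}
    (hV : IsVectorField n V) (hW : IsVectorField n W) :
    ContMDiff (𝓡 7) 𝓘(ℝ, ℝ) n (fun p => roundMetric p (V p) (W p)) :=
  (contDiff_inner (𝕜 := ℝ) (E := R8)).contMDiff.comp
    (hV.contMDiff_dincl.prodMk_space hW.contMDiff_dincl)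

theorem IsVectorField.of_le {m n : ℕ∞ω} {V : Π p : S7, TangentSpace (𝓡 7) p}
    (hV : IsVectorField n V) (h : m ≤ n) : IsVectorField m V :=
  ContMDiff.of_le hV h

theorem isVectorField_one_X (a : Fin 7) : IsVectorField 1 (X a) :=
  (isVectorField_X a).of_le (by simp)

/-! ### Brackets and divergence in the frame. -/

theorem mvfderiv_roundMetric_X {V : Π p : S7, TangentSpace (𝓡 7) p} (hV : IsVectorField 1 V)
    (k : Fin 7) (p : S7) (v : TangentSpace (𝓡 7) p) :
    mvfderiv (𝓡 7) (fun q => roundMetric q (V q) (X k q)) p v =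
      inner ℝ (dincl p (V p)) (octonionField k (dincl p v)) +
        inner ℝ (mvfderiv (𝓡 7) (fun q => dincl q (V q)) p v) (octonionField k p) := by
  simp only [roundMetric_apply, dincl_X, ← octonionMap_apply]
  have hι : MDifferentiableAt (𝓡 7) 𝓘(ℝ, R8) (fun p : S7 => (p : R8)) p :=
    (contMDiff_coe_S7 (n := 1)).mdifferentiable one_ne_zero _
  have hA : MDifferentiableAt (𝓡 7) 𝓘(ℝ, R8) (fun q : S7 => octonionMap k q) p :=
    (((octonionMap k).contDiff (n := 1)).contMDiff.comp contMDiff_coe_S7).mdifferentiable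
      one_ne_zero p
  rw [mvfderiv_inner (hV.contMDiff_dincl.mdifferentiable one_ne_zero p) hA]
  rw [mvfderiv_clm_apply _ hι]
  rfl

/-- The product rule leaves the corrections -⟨W, J_k V⟩ and ⟨V, J_k W⟩, which are equal because J_k
is skew; this is the factor 2. -/
theorem roundMetric_mlieBracket_X {V W : Π p : S7, TangentSpace (𝓡 7) p}
    (hV : IsVectorField 1 V) (hW : IsVectorField 1 W) (k : Fin 7) (p : S7) :
    roundMetric p (VectorField.mlieBracket (𝓡 7) V W p) (X k p) =
      mvfderiv (𝓡 7) (fun q => roundMetric q (W q) (X k q)) p (V p) -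
      mvfderiv (𝓡 7) (fun q => roundMetric q (V q) (X k q)) p (W p) -
      2 * inner ℝ (dincl p (W p)) (octonionField k (dincl p (V p))) := by
  rw [mvfderiv_roundMetric_X hV, mvfderiv_roundMetric_X hW, roundMetric_apply, dincl_X]
  have h := mvfderiv_mlieBracket contMDiff_coe_S7 hV hW p
  change dincl p _ = mvfderiv (𝓡 7) (fun q => dincl q (W q)) p _ -
    mvfderiv (𝓡 7) (fun q => dincl q (V q)) p _ at h
  rw [h, inner_sub_left, real_inner_comm (octonionField k (dincl p (W p))) (dincl p (V p)),
    inner_octonionField_left]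
  ring

theorem alternating_apply {p : S7} (μ : TangentSpace (𝓡 7) p [⋀^Fin 7]→ₗ[ℝ] ℝ)
    (v : Fin 7 → TangentSpace (𝓡 7) p) :
    μ v = μ (fun a => X a p) * (Matrix.of fun i j => roundMetric p (v i) (X j p)).det := by
  conv_lhs => rw [μ.eq_smul_basis_det (frame p)]
  rw [AlternatingMap.smul_apply, Module.Basis.det_apply, ← Matrix.det_transpose, smul_eq_mul]
  congr 2
  · exact funext fun a => frame_apply p a
  · ext i j
    rw [Matrix.transpose_apply, Module.Basis.toMatrix_apply, frame_repr]
    rfl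

/-- The divergence formula in the frame `X`. -/
theorem lieDerivForm_eq {μ : Π p : S7, TangentSpace (𝓡 7) p [⋀^Fin 7]→ₗ[ℝ] ℝ}
    (hμ : ContMDiff (𝓡 7) 𝓘(ℝ, ℝ) 1 (fun p => μ p (fun a => X a p)))
    (hμ' : ∀ p, mvfderiv (𝓡 7) (fun p => μ p (fun a => X a p)) p = 0)
    {G : Π p : S7, TangentSpace (𝓡 7) p} (hG : IsVectorField 1 G)
    {Y : Fin 7 → Π p : S7, TangentSpace (𝓡 7) p} (hY : ∀ i, IsVectorField 1 (Y i)) (p : S7) :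
    lieDerivForm μ G Y p =
      (∑ a, mvfderiv (𝓡 7) (fun q => roundMetric q (G q) (X a q)) p (X a p)) *
        μ p (fun i => Y i p) := by
  have hy : ∀ i j, ContMDiff (𝓡 7) 𝓘(ℝ, ℝ) 1 (fun q => roundMetric q (Y i q) (X j q)) :=
    fun i j => contMDiff_roundMetric (hY i) (isVectorField_one_X j)
  have hdet : ContMDiff (𝓡 7) 𝓘(ℝ, ℝ) 1
      (fun q => (Matrix.of fun i j => roundMetric q (Y i q) (X j q)).det) := by
    exact contMDiff_det hy
  set A : Matrix (Fin 7) (Fin 7) ℝ := Matrix.of fun i j => roundMetric p (Y i p) (X j p) with hA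
  -- With y_ij = ⟨Y_i, X_j⟩, the bracket formula reads ⟨[G, Y_i], X_k⟩ = G y_ik - (A B)_ik, so `B`
  -- is the matrix of -[G, ·] on the frame.
  let B : Matrix (Fin 7) (Fin 7) ℝ := Matrix.of fun j k =>
    mvfderiv (𝓡 7) (fun q => roundMetric q (G q) (X k q)) p (X j p) +
      2 * inner ℝ (octonionField j p) (octonionField k (dincl p (G p)))
  have hB : ∀ i k, (A * B) i k = mvfderiv (𝓡 7) (fun q => roundMetric q (G q) (X k q)) p (Y i p) +
      2 * inner ℝ (dincl p (Y i p)) (octonionField k (dincl p (G p))) := fun i k => by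
    have h1 := sum_roundMetric_smul_X p (Y i p)
    conv_rhs => rw [← h1]
    simp only [map_sum, map_smul, sum_inner, real_inner_smul_left, dincl_X, Matrix.mul_apply,
      Finset.mul_sum, ← Finset.sum_add_distrib, smul_eq_mul, A, B, Matrix.of_apply]
    exact Finset.sum_congr rfl fun j _ => by ring
  have htr : B.trace = ∑ a, mvfderiv (𝓡 7) (fun q => roundMetric q (G q) (X a q)) p (X a p) := by
    refine Finset.sum_congr rfl fun a _ => ?_
    simp only [B, Matrix.diag_apply, Matrix.of_apply]
    -- ⟨J_a p, J_a G⟩ = -⟨p, J_a² G⟩ = ⟨p, G⟩ = 0, as G is tangent to the sphere.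
    rw [inner_octonionField_left, octonionField_octonionField, inner_neg_right, inner_dincl]
    simp
  have h1 : derivAlong G (fun q => μ q (fun i => Y i q)) p = μ p (fun a => X a p) *
      ∑ i, (A.updateRow i fun j =>
        mvfderiv (𝓡 7) (fun q => roundMetric q (Y i q) (X j q)) p (G p)).det := by
    have h : (fun q => μ q (fun i => Y i q)) = (fun q => μ q (fun a => X a q)) *
        fun q => (Matrix.of fun i j => roundMetric q (Y i q) (X j q)).det :=
      funext fun q => alternating_apply (μ q) fun i => Y i q
    rw [derivAlong, h, mvfderiv_mul (hμ.mdifferentiable one_ne_zero p)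
      (hdet.mdifferentiable one_ne_zero p), hμ', smul_zero, add_zero, ← mvfderiv_det hy]
    rfl
  have h2 : ∀ i, μ p (Function.update (fun j => Y j p) i
      (VectorField.mlieBracket (𝓡 7) G (Y i) p)) = μ p (fun a => X a p) *
      ((A.updateRow i fun j =>
        mvfderiv (𝓡 7) (fun q => roundMetric q (Y i q) (X j q)) p (G p)).det -
        (A.updateRow i ((A * B) i)).det) := fun i => by
    have h : (Matrix.of fun i' j => roundMetric p (Function.update (fun j => Y j p) i
        (VectorField.mlieBracket (𝓡 7) G (Y i) p) i') (X j p)) = A.updateRow i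
        (roundMetric p (VectorField.mlieBracket (𝓡 7) G (Y i) p) <| X · p) := by
      ext i' j
      rcases eq_or_ne i' i with rfl | hi
      · simp
      · simp [hi, hA]
    have hr : (fun j => mvfderiv (𝓡 7) (fun q => roundMetric q (Y i q) (X j q)) p (G p)) =
        (roundMetric p (VectorField.mlieBracket (𝓡 7) G (Y i) p) <| X · p) + (A * B) i := by
      ext k
      rw [Pi.add_apply, hB, roundMetric_mlieBracket_X hG (hY i)]
      ring
    rw [alternating_apply, h, hr, Matrix.det_updateRow_add]
    ring
  rw [lieDerivForm, h1, alternating_apply (μ p) fun i => Y i p]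
  simp only [h2]
  rw [← Finset.mul_sum, Finset.sum_sub_distrib, sum_det_updateRow_mul, htr]
  ring

/-! ### The horizontal gradient and its divergence. -/

theorem derivAlong_X_contMDiff {f : S7 → ℝ} (hf : ContMDiff (𝓡 7) 𝓘(ℝ, ℝ) 2 f) (a : Fin 7) :
    ContMDiff (𝓡 7) 𝓘(ℝ, ℝ) 1 (derivAlong (X a) f) :=
  (isVectorField_one_X a).contMDiff_mvfderiv hf (by norm_num)

/-- The horizontal gradient `∑ₐ (Xₐ f) Xₐ`. -/
noncomputable def horizontalGradient (f : S7 → ℝ) (p : S7) : contactS7.dist p :=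
  ∑ a : Fin 6, derivAlong (X a.succ) f p • ⟨X a.succ p, X_succ_mem_dist p a⟩

theorem coe_horizontalGradient (f : S7 → ℝ) (p : S7) :
    (horizontalGradient f p : TangentSpace (𝓡 7) p) =
      ∑ a : Fin 6, derivAlong (X a.succ) f p • X a.succ p := by
  simp [horizontalGradient]

theorem metric_apply {p : S7} (v w : contactS7.dist p) :
    contactS7.metric p v w = roundMetric p v w := rfl

theorem roundMetric_horizontalGradient_zero (f : S7 → ℝ) (p : S7) :
    roundMetric p (horizontalGradient f p : TangentSpace (𝓡 7) p) (X 0 p) = 0 :=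
  mem_dist_iff.1 (horizontalGradient f p).2

theorem roundMetric_horizontalGradient_succ (f : S7 → ℝ) (p : S7) (a : Fin 6) :
    roundMetric p (horizontalGradient f p : TangentSpace (𝓡 7) p) (X a.succ p) =
      derivAlong (X a.succ) f p := by
  simp [coe_horizontalGradient, roundMetric_X]

theorem isHorizontalGradient_iff (f : S7 → ℝ) (G : Π p : S7, contactS7.dist p) :
    contactS7.IsHorizontalGradient f G ↔ G = horizontalGradient f := by
  have h0 : contactS7.IsHorizontalGradient f (horizontalGradient f) := fun p v => by
    rw [metric_apply, roundMetric_eq_sum, Fin.sum_univ_succ, mem_dist_iff.1 v.2, mul_zero, zero_add]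
    conv_rhs => rw [← sum_roundMetric_smul_X p v, Fin.sum_univ_succ, mem_dist_iff.1 v.2]
    simp only [zero_smul, zero_add, map_sum, map_smul, roundMetric_horizontalGradient_succ,
      smul_eq_mul]
    exact Finset.sum_congr rfl fun a _ => mul_comm _ _
  refine ⟨fun h => ?_, fun h => h ▸ h0⟩
  funext p
  by_contra hne
  have hv : ((G p - horizontalGradient f p : contactS7.dist p) : TangentSpace (𝓡 7) p) ≠ 0 :=
    fun h => hne (sub_eq_zero.1 (Subtype.ext h))
  -- Testing both gradients against their difference contradicts positivity.
  have h2 := roundMetric_self_pos hv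
  rw [← metric_apply, LinearMap.map_sub₂, h p, h0 p, sub_self] at h2
  exact lt_irrefl _ h2

theorem isVectorField_horizontalGradient {f : S7 → ℝ} (hf : ContMDiff (𝓡 7) 𝓘(ℝ, ℝ) 2 f) :
    IsVectorField 1 (fun p => (horizontalGradient f p : TangentSpace (𝓡 7) p)) := by
  simp only [coe_horizontalGradient]
  exact ContMDiff.sum_section fun a _ =>
    (derivAlong_X_contMDiff hf a.succ).smul_section (isVectorField_one_X a.succ)

theorem isDivergence_horizontalGradient_iff {f : S7 → ℝ} (hf : ContMDiff (𝓡 7) 𝓘(ℝ, ℝ) 2 f)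
    {μ : Π p : S7, TangentSpace (𝓡 7) p [⋀^Fin 7]→ₗ[ℝ] ℝ} (hμ : IsSmoothForm μ) {c : ℝ}
    (hc : c ≠ 0) (hμc : ∀ p, |μ p (fun a => X a p)| = c) (h : S7 → ℝ) :
    IsDivergence μ (fun p => (horizontalGradient f p : TangentSpace (𝓡 7) p)) h ↔
      h = ∑ a : Fin 6, derivAlong (X a.succ) (derivAlong (X a.succ) f) := by
  set u : S7 → ℝ := fun p => μ p (fun a => X a p) with hu
  have hu0 : ∀ p, u p ≠ 0 := fun p h0 => hc (by rw [← hμc p]; exact abs_eq_zero.2 h0)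
  have hu1 : ContMDiff (𝓡 7) 𝓘(ℝ, ℝ) 1 u := (hμ X isVectorField_X).of_le (by simp)
  -- Only |u| is known to be constant. From u² = c² follows 2u du = 0, hence du = 0, with no appeal
  -- to connectedness.
  have hu' : ∀ p, mvfderiv (𝓡 7) u p = 0 := fun p => by
    have h1 : u * u = fun _ => c * c := funext fun q => by
      rw [← hμc q, abs_mul_abs_self]; rfl
    have h2 := mvfderiv_mul (hu1.mdifferentiable one_ne_zero p) (hu1.mdifferentiable one_ne_zero p)
    rw [h1, mvfderiv_const, ← two_smul ℝ] at h2
    exact ((smul_eq_zero.1 ((smul_eq_zero.1 h2.symm).resolve_left two_ne_zero)).resolve_left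
      (hu0 p))
  have hG := isVectorField_horizontalGradient hf
  have hsum : ∀ p, ∑ a, mvfderiv (𝓡 7) (fun q =>
      roundMetric q (horizontalGradient f q : TangentSpace (𝓡 7) q) (X a q)) p (X a p) =
      (∑ a : Fin 6, derivAlong (X a.succ) (derivAlong (X a.succ) f)) p := fun p => by
    rw [Fin.sum_univ_succ]
    simp only [roundMetric_horizontalGradient_zero, roundMetric_horizontalGradient_succ,
      mvfderiv_const, Finset.sum_apply]
    exact zero_add _
  constructor
  · intro hd
    funext p
    -- The divergence is unique: on the frame itself `μ` does not vanish and can be cancelled.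
    have h1 := hd.2 X isVectorField_X p
    rw [lieDerivForm_eq hu1 hu' hG isVectorField_one_X, hsum] at h1
    exact (mul_right_cancel₀ (hu0 p) h1).symm
  · rintro rfl
    refine ⟨hG, fun Y hY p => ?_⟩
    rw [lieDerivForm_eq hu1 hu' hG fun i => (hY i).of_le (by simp), hsum]

/-! ### Popp's norm. -/

/-- The horizontal frame `X₂, …, X₇`. -/
noncomputable def horizontalFrame (a : Fin 6) (p : S7) : contactS7.dist p :=
  ⟨X a.succ p, X_succ_mem_dist p a⟩

theorem isSmoothHorizontal_horizontalFrame (a : Fin 6) :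
    contactS7.IsSmoothHorizontal (horizontalFrame a) :=
  isVectorField_X a.succ

theorem isOrthonormalBasisAt_horizontalFrame (p : S7) :
    contactS7.IsOrthonormalBasisAt p (fun a => horizontalFrame a p) := by
  refine ⟨fun i j => ?_, ?_⟩
  · rw [metric_apply]
    exact (roundMetric_X p _ _).trans (by simp)
  · refine eq_top_iff.2 fun v _ => ?_
    have hv : v = ∑ a : Fin 6, roundMetric p v (X a.succ p) • horizontalFrame a p := by
      ext1
      conv_lhs => rw [← sum_roundMetric_smul_X p v, Fin.sum_univ_succ, mem_dist_iff.1 v.2]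
      simp [horizontalFrame]
    rw [hv]
    exact Submodule.sum_mem _ fun a _ => Submodule.smul_mem _ _ (Submodule.subset_span ⟨a, rfl⟩)

/-- `ω([V, W]) = -2 ⟨J V, W⟩` for horizontal fields `V`, `W`. -/
theorem roundMetric_bracket_X_zero {V W : Π p : S7, contactS7.dist p}
    (hV : contactS7.IsSmoothHorizontal V) (hW : contactS7.IsSmoothHorizontal W) (p : S7) :
    roundMetric p (contactS7.bracket V W p) (X 0 p) = -2 *
      inner ℝ (dincl p (W p)) (octonionField 0 (dincl p (V p))) := by
  rw [PreStructure.bracket, roundMetric_mlieBracket_X (IsVectorField.of_le hV (by simp))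
    (IsVectorField.of_le hW (by simp))]
  simp only [mem_dist_iff.1 (V _).2, mem_dist_iff.1 (W _).2, mvfderiv_const]
  simp

/-- J_0 X_i is again a horizontal unit vector, so by Parseval each of the six rows sums to 4|J_0
X_i|² = 4. -/
theorem sum_sq_bracket_horizontalFrame (p : S7) :
    ∑ i, ∑ j, roundMetric p (contactS7.bracket (horizontalFrame i) (horizontalFrame j) p)
      (X 0 p) ^ 2 = 24 := by
  have h : ∀ i, ∑ j, roundMetric p (contactS7.bracket (horizontalFrame i) (horizontalFrame j) p)
      (X 0 p) ^ 2 = 4 := fun i => by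
    simp only [roundMetric_bracket_X_zero (isSmoothHorizontal_horizontalFrame _)
      (isSmoothHorizontal_horizontalFrame _)]
    obtain ⟨w, hw⟩ := exists_dincl_eq_of_inner_eq_zero (p := p)
      (w := octonionField 0 (dincl p (X i.succ p))) (by
        rw [← neg_inj, ← inner_octonionField_left, dincl_X, inner_octonionField_octonionField,
          if_neg (Fin.succ_ne_zero i).symm, neg_zero])
    have hw0 : roundMetric p w (X 0 p) = 0 := by
      rw [roundMetric_apply, hw, dincl_X 0, inner_octonionField_left, octonionField_octonionField,
        inner_neg_right, real_inner_comm, inner_dincl, neg_zero, neg_zero]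
    have hww : roundMetric p w w = 1 := by
      rw [roundMetric_apply, hw, inner_octonionField_octonionField, if_pos rfl,
        ← roundMetric_apply, roundMetric_X, if_pos rfl]
    rw [roundMetric_eq_sum, Fin.sum_univ_succ, hw0, mul_zero, zero_add] at hww
    calc _ = 4 * ∑ j : Fin 6, roundMetric p w (X j.succ p) * roundMetric p w (X j.succ p) := by
          rw [Finset.mul_sum]
          refine Finset.sum_congr rfl fun j _ => ?_
          rw [roundMetric_comm, roundMetric_apply, hw]
          change (-2 * inner ℝ (dincl p (X j.succ p)) (octonionField 0 (dincl p (X i.succ p)))) ^ 2 = _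
          ring
      _ = 4 := by rw [hww, mul_one]
  simp only [h]
  norm_num

theorem orthonormal_dincl_of_isOrthonormalBasisAt {p : S7} {e : Fin 6 → contactS7.dist p}
    (he : contactS7.IsOrthonormalBasisAt p e) :
    Orthonormal ℝ (fun i => dincl p (e i)) :=
  orthonormal_iff_ite.2 he.1

/-- For an arbitrary orthonormal frame Bessel's inequality suffices: only the upper bound is needed
to bound Popp's norm from below. -/
theorem sum_sq_bracket_le {p : S7} {F : Fin 6 → Π x : S7, contactS7.dist x}
    (hF : ∀ i, contactS7.IsSmoothHorizontal (F i))
    (he : contactS7.IsOrthonormalBasisAt p (fun i => F i p)) :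
    ∑ i, ∑ j, roundMetric p (contactS7.bracket (F i) (F j) p) (X 0 p) ^ 2 ≤ 24 := by
  have h : ∀ i ∈ Finset.univ, ∑ j, roundMetric p (contactS7.bracket (F i) (F j) p) (X 0 p) ^ 2
      ≤ 4 := fun i _ => by
    have h1 := (orthonormal_dincl_of_isOrthonormalBasisAt he).sum_inner_products_le
      (octonionField 0 (dincl p (F i p))) (s := Finset.univ)
    rw [← real_inner_self_eq_norm_sq, inner_octonionField_octonionField, if_pos rfl,
      ← roundMetric_apply, ← metric_apply, he.1, if_pos rfl] at h1
    calc _ = 4 * ∑ j, ‖inner ℝ (dincl p (F j p)) (octonionField 0 (dincl p (F i p)))‖ ^ 2 := by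
          rw [Finset.mul_sum]
          refine Finset.sum_congr rfl fun j _ => ?_
          rw [roundMetric_bracket_X_zero (hF i) (hF j), Real.norm_eq_abs, sq_abs]
          ring
      _ ≤ 4 := by linarith
  refine (Finset.sum_le_sum h).trans ?_
  norm_num

/-- Put b_ij = ω([F_i, F_j]). The constraint on a is ∑ a_ij b_ij = ω(u), and ∑ b_ij² ≤ 24, so
Cauchy-Schwarz gives the lower bound. It is attained for the frame X with a proportional to b. -/
theorem poppNormSq_eq (p : S7) (u : TangentSpace (𝓡 7) p) :
    contactS7.poppNormSq 6 p u = roundMetric p u (X 0 p) ^ 2 / 24 := by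
  refine IsLeast.csInf_eq ⟨?_, ?_⟩
  · have h24 := sum_sq_bracket_horizontalFrame p
    refine ⟨horizontalFrame, fun i j => roundMetric p u (X 0 p) / 24 *
      roundMetric p (contactS7.bracket (horizontalFrame i) (horizontalFrame j) p) (X 0 p),
      isSmoothHorizontal_horizontalFrame, isOrthonormalBasisAt_horizontalFrame p, ?_, ?_⟩
    · rw [mem_dist_iff]
      simp only [map_sub, map_sum, map_smul, LinearMap.sub_apply, LinearMap.sum_apply,
        LinearMap.smul_apply, smul_eq_mul, mul_assoc, ← Finset.mul_sum, ← pow_two, h24]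
      ring
    · simp only [mul_pow, ← Finset.mul_sum, h24]
      ring
  · rintro s ⟨F, a, hF, he, hu, rfl⟩
    rw [mem_dist_iff] at hu
    simp only [map_sub, map_sum, map_smul, LinearMap.sub_apply, LinearMap.sum_apply,
      LinearMap.smul_apply, smul_eq_mul, sub_eq_zero] at hu
    have h24 := sum_sq_bracket_le hF he
    have hcs := Finset.sum_mul_sq_le_sq_mul_sq (Finset.univ : Finset (Fin 6 × Fin 6))
      (fun q => a q.1 q.2)
      (fun q => roundMetric p (contactS7.bracket (F q.1) (F q.2) p) (X 0 p))
    simp only [Fintype.sum_prod_type] at hcs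
    rw [← hu] at hcs
    have h0 : 0 ≤ ∑ i, ∑ j, a i j ^ 2 := by positivity
    rw [div_le_iff₀ (by norm_num)]
    exact hcs.trans (mul_le_mul_of_nonneg_left h24 h0)

theorem isRegularStepTwo_contactS7 : contactS7.IsRegularStepTwo 6 1 where
  finrank_tangent := finrank_euclideanSpace_fin
  finrank_dist p := by
    rw [dist_eq_span]
    exact (finrank_span_eq_card ((linearIndependent_X p).comp _ (Fin.succ_injective 6))).trans
      (Fintype.card_fin 6)
  exists_frame p := ⟨horizontalFrame, isSmoothHorizontal_horizontalFrame,
    Filter.Eventually.of_forall fun x => LinearIndependent.of_comp (contactS7.dist x).subtype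
      ((linearIndependent_X x).comp _ (Fin.succ_injective 6))⟩
  symm p v w := roundMetric_comm p v w
  pos p v hv := roundMetric_self_pos fun h => hv (Subtype.ext h)
  smooth_metric V W hV hW := contMDiff_roundMetric hV hW
  bracket_generating p := by
    -- Some bracket leaves the hyperplane H_p, since the squares of the transverse components sum to
    -- 24.
    obtain ⟨i, j, hij⟩ : ∃ i j, roundMetric p
        (contactS7.bracket (horizontalFrame i) (horizontalFrame j) p) (X 0 p) ≠ 0 := by
      by_contra! h
      have h24 := sum_sq_bracket_horizontalFrame p
      simp [h] at h24
    refine eq_top_iff.2 fun v _ => ?_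
    set u := contactS7.bracket (horizontalFrame i) (horizontalFrame j) p with hu
    rw [← sub_add_cancel v ((roundMetric p v (X 0 p) / roundMetric p u (X 0 p)) • u)]
    refine Submodule.add_mem_sup (mem_dist_iff.2 ?_) (Submodule.smul_mem _ _
      (Submodule.subset_span ⟨_, _, isSmoothHorizontal_horizontalFrame i,
        isSmoothHorizontal_horizontalFrame j, hu⟩))
    simp [hij]

/-! ### Popp's volume. -/

theorem isPoppFrameAt_horizontalFrame (p : S7) :
    contactS7.IsPoppFrameAt p (fun a => horizontalFrame a p)
      (fun _ : Fin 1 => √24 • X 0 p) := by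
  refine ⟨isOrthonormalBasisAt_horizontalFrame p, fun c => ?_, ?_⟩
  · rw [poppNormSq_eq]
    simp [roundMetric_X, mul_pow]
  · refine eq_top_iff.2 fun v _ => ?_
    rw [← sub_add_cancel v ((roundMetric p v (X 0 p) / √24) • √24 • X 0 p)]
    refine Submodule.add_mem_sup (mem_dist_iff.2 ?_) (Submodule.smul_mem _ _
      (Submodule.subset_span ⟨0, rfl⟩))
    simp [roundMetric_X]

/-- In the frame X the first column is zero except for its last entry ±√24, and the complementary 6
× 6 minor is an orthogonal matrix. -/
theorem abs_det_of_isPoppFrameAt {p : S7} {e : Fin 6 → contactS7.dist p}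
    {z : Fin 1 → TangentSpace (𝓡 7) p} (h : contactS7.IsPoppFrameAt p e z) :
    |(Matrix.of fun i j : Fin 7 => roundMetric p
      (Fin.append (fun i => (e i : TangentSpace (𝓡 7) p)) z i) (X j p)).det| = √24 := by
  have hz : roundMetric p (z 0) (X 0 p) ^ 2 = 24 := by
    have h1 := h.2.1 fun _ => 1
    rw [poppNormSq_eq] at h1
    simp at h1
    linarith
  set O : Matrix (Fin 6) (Fin 6) ℝ := Matrix.of fun i j => roundMetric p (e i) (X j.succ p) with hO
  have hOO : O * O.transpose = 1 := by
    ext i j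
    have h1 := h.1.1 i j
    rw [metric_apply, roundMetric_eq_sum, Fin.sum_univ_succ, mem_dist_iff.1 (e i).2, zero_mul,
      zero_add] at h1
    rw [Matrix.one_apply, ← h1]
    rfl
  have hdet : |O.det| = 1 := by
    have h1 := congrArg Matrix.det hOO
    rw [Matrix.det_mul, Matrix.det_transpose, Matrix.det_one] at h1
    rw [← sq_eq_sq₀ (abs_nonneg _) zero_le_one, sq_abs, pow_two, h1, one_pow]
  have he : ∀ i : Fin 6, (Fin.append (fun i => (e i : TangentSpace (𝓡 7) p)) z : Fin 7 → _)
      i.castSucc = e i := fun i => Fin.append_left _ _ i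
  have hl : (Fin.append (fun i => (e i : TangentSpace (𝓡 7) p)) z : Fin 7 → _)
      (Fin.last 6) = z 0 := Fin.append_right _ _ (0 : Fin 1)
  have hsub : (Matrix.of fun i j : Fin 7 => roundMetric p
      (Fin.append (fun i => (e i : TangentSpace (𝓡 7) p)) z i) (X j p)).submatrix
      (Fin.last 6).succAbove Fin.succ = O := by
    ext i j
    simp only [Matrix.submatrix_apply, Matrix.of_apply, Fin.succAbove_last, hO]
    rw [he]
  rw [Matrix.det_succ_column_zero, Fin.sum_univ_castSucc, hsub]
  simp only [Matrix.of_apply]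
  rw [hl, Finset.sum_eq_zero fun i _ => by rw [he, mem_dist_iff.1 (e i).2]; simp, zero_add,
    abs_mul, hdet, mul_one, abs_mul, abs_pow, abs_neg, abs_one, one_pow, one_mul, ← hz,
    Real.sqrt_sq_eq_abs]

/-- All Popp frames have the same |det| = √24 relative to X, so the condition on all of them is one
condition on |μ(X)|; the explicit Popp frame gives the forward direction. -/
theorem isPoppVolume_iff (μ : Π p : S7, TangentSpace (𝓡 7) p [⋀^Fin (6 + 1)]→ₗ[ℝ] ℝ) :
    contactS7.IsPoppVolume 6 1 μ ↔
      IsSmoothForm μ ∧ ∀ p, |μ p (fun a : Fin 7 => X a p)| = (√24)⁻¹ := by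
  have h24 : √24 ≠ 0 := by positivity
  have key : ∀ {p : S7} {e : Fin 6 → contactS7.dist p} {z : Fin 1 → TangentSpace (𝓡 7) p},
      contactS7.IsPoppFrameAt p e z →
      |μ p (Fin.append (fun i => (e i : TangentSpace (𝓡 7) p)) z)| =
        |μ p (fun a : Fin 7 => X a p)| * √24 := fun {p e z} h => by
    rw [← abs_det_of_isPoppFrameAt h, ← abs_mul]
    exact congrArg _ (alternating_apply (μ p) _)
  refine and_congr_right fun _ => ⟨fun h p => ?_, fun h p e z hez => ?_⟩
  · exact eq_inv_of_mul_eq_one_left ((key (isPoppFrameAt_horizontalFrame p)).symm.trans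
      (h p _ _ (isPoppFrameAt_horizontalFrame p)))
  · rw [key hez, h, inv_mul_cancel₀ h24]

theorem exists_isPoppVolume : ∃ μ, contactS7.IsPoppVolume 6 1 μ := by
  have hX : ∀ p, (frame p).det (fun a => X a p) = 1 := fun p =>
    (congrArg _ (funext fun a => (frame_apply p a).symm)).trans (frame p).det_self
  refine ⟨fun p => (√24)⁻¹ • (frame p).det, (isPoppVolume_iff _).2 ⟨fun Y hY => ?_, fun p => ?_⟩⟩
  · have h : (fun p => ((√24)⁻¹ • (frame p).det) (fun i => Y i p)) = fun p =>
        (√24)⁻¹ • (Matrix.of fun i j => roundMetric p (Y i p) (X j p)).det := funext fun p => by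
      rw [AlternatingMap.smul_apply, alternating_apply, hX, one_mul]
    rw [h]
    exact (contDiff_const_smul (𝕜 := ℝ) (F := ℝ) (√24)⁻¹).contMDiff.comp
      (contMDiff_det fun i j => contMDiff_roundMetric (hY i) (isVectorField_X j))
  · rw [AlternatingMap.smul_apply, hX, smul_eq_mul, mul_one, abs_of_nonneg (by positivity)]

/-! ### The intrinsic sub-Laplacian. -/

theorem isIntrinsicSubLaplacian_contactS7_iff {f : S7 → ℝ} (hf : ContMDiff (𝓡 7) 𝓘(ℝ, ℝ) 2 f)
    (h : S7 → ℝ) :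
    contactS7.IsIntrinsicSubLaplacian 6 1 f h ↔
      h = ∑ a : Fin 6, derivAlong (X a.succ) (derivAlong (X a.succ) f) := by
  have hc : (√24)⁻¹ ≠ 0 := by positivity
  constructor
  · rintro ⟨μ, hμ, G, hG, hd⟩
    obtain rfl := (isHorizontalGradient_iff f G).1 hG
    have hμ' := (isPoppVolume_iff μ).1 hμ
    exact (isDivergence_horizontalGradient_iff hf hμ'.1 hc hμ'.2 h).1 hd
  · intro hh
    obtain ⟨μ, hμ⟩ := exists_isPoppVolume
    have hμ' := (isPoppVolume_iff μ).1 hμ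
    exact ⟨μ, hμ, horizontalGradient f, (isHorizontalGradient_iff f _).2 rfl,
      (isDivergence_horizontalGradient_iff hf hμ'.1 hc hμ'.2 h).2 hh⟩

end SubRiem

theorem mainTheorem1 :
    (∀ (p : SubRiem.S7) (a b : Fin 7),
      SubRiem.roundMetric p (SubRiem.X a p) (SubRiem.X b p) = if a = b then 1 else 0) ∧
    (∀ p : SubRiem.S7, SubRiem.contactS7.dist p =
      Submodule.span ℝ (Set.range fun a : Fin 6 => SubRiem.X a.succ p)) ∧
    SubRiem.contactS7.IsRegularStepTwo 6 1 ∧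
    ∀ f : SubRiem.S7 → ℝ, ContMDiff (𝓡 7) 𝓘(ℝ, ℝ) 2 f → ∀ h : SubRiem.S7 → ℝ,
      SubRiem.contactS7.IsIntrinsicSubLaplacian 6 1 f h ↔
        h = ∑ a : Fin 6, SubRiem.derivAlong (SubRiem.X a.succ)
          (SubRiem.derivAlong (SubRiem.X a.succ) f) :=
  ⟨SubRiem.roundMetric_X, SubRiem.dist_eq_span, SubRiem.isRegularStepTwo_contactS7,
    fun _ hf h => SubRiem.isIntrinsicSubLaplacian_contactS7_iff hf h⟩
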